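/- **Gradient descent with improved learning rate for two-layer ReLU networks.** Let $n,d\ge 1$, let $x_1,\dots,x_n\in\mathbb R^d$ with $\|x_i\|=1$ and let $y_1,\dots,y_n\in\mathbb R$ with $|y_i|\le B$. For $W=(w_1,\dots,w_m)\in(\mathbb R^d)^m$ and $a\in\mathbb R^m$ let $$f(W,a,x)=\frac1{\sqrt m}\sum_{r=1}^m a_r\,\sigma(\langle w_r,x\rangle),\qquad \sigma(z)=\max(z,0),\qquad L(W)=\frac12\sum_{i=1}^n\bigl(f(W,a,x_i)-y_i\bigr)^2 .$$ Initialize $w_r(0)\sim N(0,I_d)$ and $a_r\sim U(\{-1,1\})$, all independent; keep $a$ fixed and run full-batch gradient descent on the first layer, $w_r(k+1)=w_r(k)-\eta\,\frac{\partial L(W(k))}{\partial w_r}$, where $$\frac{\partial L(W)}{\partial w_r}=\frac1{\sqrt m}\sum_{i=1}^n\bigl(f(W,a,x_i)-y_i\bigr)\,a_r\,\mathbb 1\{\langle w_r,x_i\rangle\ge 0\}\,x_i$$ (so $\sigma'(0)=1$ by convention). Let $H^\infty\in\mathbb R^{n\times n}$ be the Gram matrix $$H^\infty_{ij}=\mathbb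 E_{w\sim N(0,I_d)}\bigl[\langle x_i,x_j\rangle\,\mathbb 1\{\langle w,x_i\rangle\ge0,\ \langle w,x_j\rangle\ge0\}\bigr],$$ let $\|H^\infty\|$ be its largest eigenvalue, and assume that its smallest eigenvalue $\lambda_0=\lambda_{\min}(H^\infty)$ is positive. For all $0<c_2<2$ and $B\ge0$ there is a constant $C>0$, depending only on $c_2$ and $B$, and for every $0<c_1\le c_2$ there is a constant $K>0$, depending only on $c_1,c_2,B$, such that the following holds for all data as above and all $\delta\in(0,1)$, $\varepsilon\in(0,1]$. If $$m\ \ge\ C\,\frac{n^8}{\lambda_0^4\,\delta^3}\qquad\text{and}\qquad \frac{c_1}{\|H^\infty\|}\ \le\ \eta\ \le\ \frac{c_2}{\|H^\infty\|},$$ then with probability at least $1-\delta$ over the random initialization, $L(W(T))\le\varepsilon$ for every integer $$T\ \ge\ K\,\frac{\|H^\infty\|}{\lambda_0}\Bigl(\log\frac1\varepsilon+\log\frac n\delta+1\Bigr).$$ -/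

import Mathlib

open MeasureTheory ProbabilityTheory
open scoped RealInnerProductSpace

noncomputable section

namespace TwoLayer

/-- The ReLU activation `σ(z) = max(z, 0)`. -/
def relu (z : ℝ) : ℝ := max z 0

/-- The derivative `σ'(z) = 𝟙{z ≥ 0}` of the ReLU, with the usual convention `σ'(0) = 1`. -/
def reluDeriv (z : ℝ) : ℝ := if 0 ≤ z then 1 else 0

/-- First-layer weights: one vector `w_r ∈ ℝ^d` for each of the `m` hidden units. -/
abbrev Weights (m d : ℕ) : Type := Fin m → EuclideanSpace ℝ (Fin d)

variable {n m d : ℕ}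

/-- The network `f(W, a, x) = (1/√m) ∑_r a_r σ(⟨w_r, x⟩)`. -/
def net (a : Fin m → ℝ) (W : Weights m d) (x : EuclideanSpace ℝ (Fin d)) : ℝ :=
  (1 / √(m : ℝ)) * ∑ r, a r * relu ⟪W r, x⟫

/-- The quadratic loss `L(W) = ∑_i (1/2) (f(W, a, x_i) - y_i)²`. -/
def loss (x : Fin n → EuclideanSpace ℝ (Fin d)) (y : Fin n → ℝ) (a : Fin m → ℝ)
    (W : Weights m d) : ℝ :=
  ∑ i, (1 / 2 : ℝ) * (net a W (x i) - y i) ^ 2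

/-- The partial gradient `∂L/∂w_r = (1/√m) ∑_i (f(W, a, x_i) - y_i) a_r 𝟙{⟨w_r, x_i⟩ ≥ 0} x_i`. -/
def lossGrad (x : Fin n → EuclideanSpace ℝ (Fin d)) (y : Fin n → ℝ) (a : Fin m → ℝ)
    (W : Weights m d) (r : Fin m) : EuclideanSpace ℝ (Fin d) :=
  (1 / √(m : ℝ)) • ∑ i, ((net a W (x i) - y i) * a r * reluDeriv ⟪W r, x i⟫) • x i

/-- Full-batch gradient descent on the first layer with constant step size `η`:
`w_r(k+1) = w_r(k) - η ∂L(W(k))/∂w_r`, started from `W0`. -/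
def gd (x : Fin n → EuclideanSpace ℝ (Fin d)) (y : Fin n → ℝ) (η : ℝ) (a : Fin m → ℝ)
    (W0 : Weights m d) : ℕ → Weights m d
  | 0 => W0
  | k + 1 => fun r => gd x y η a W0 k r - η • lossGrad x y a (gd x y η a W0 k) r

/-- The Gram matrix `H^∞_{ij} = E_{w ∼ N(0,I)} [⟨x_i, x_j⟩ 𝟙{⟨w, x_i⟩ ≥ 0, ⟨w, x_j⟩ ≥ 0}]`. -/
def gramInf (x : Fin n → EuclideanSpace ℝ (Fin d)) : Matrix (Fin n) (Fin n) ℝ :=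
  Matrix.of fun i j =>
    ∫ w, ⟪x i, x j⟫ * (if 0 ≤ ⟪w, x i⟫ ∧ 0 ≤ ⟪w, x j⟫ then (1 : ℝ) else 0)
      ∂(stdGaussian (EuclideanSpace ℝ (Fin d)))

/-- The smallest eigenvalue of a real symmetric matrix of positive size. -/
def lamMin (A : Matrix (Fin n) (Fin n) ℝ) : ℝ := sInf (spectrum ℝ A)

/-- The largest eigenvalue of a real symmetric matrix of positive size; for the positive
semidefinite matrix `H^∞` this is the operator norm `‖H^∞‖`. -/
def lamMax (A : Matrix (Fin n) (Fin n) ℝ) : ℝ := sSup (spectrum ℝ A)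

/-- The law of the initialization `(W(0), a)`: the `w_r(0) ∼ N(0, I)` and the signs
`a_r ∼ U({-1, 1})`, `r = 1, …, m`, are all independent. -/
def initLaw (m d : ℕ) : Measure (Weights m d × (Fin m → ℝ)) :=
  (Measure.pi fun _ : Fin m => stdGaussian (EuclideanSpace ℝ (Fin d))).prod
    (Measure.pi fun _ : Fin m => uniformOn ({-1, 1} : Set ℝ))

theorem hasDerivAt_relu {z : ℝ} (hz : z ≠ 0) : HasDerivAt relu (reluDeriv z) z := by
  rcases lt_or_gt_of_ne hz with h | h
  · have h0 : reluDeriv z = 0 := by simp [reluDeriv, not_le.mpr h]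
    rw [h0]
    refine (hasDerivAt_const z (0 : ℝ)).congr_of_eventuallyEq ?_
    filter_upwards [eventually_lt_nhds h] with t ht
    simp [relu, ht.le]
  · have h0 : reluDeriv z = 1 := by simp [reluDeriv, h.le]
    rw [h0]
    refine (hasDerivAt_id z).congr_of_eventuallyEq ?_
    filter_upwards [eventually_gt_nhds h] with t ht
    simp [relu, ht.le]

/-- `lossGrad` is the true gradient of the loss in `w_r` wherever no data point is on the kink. -/
theorem hasGradientAt_loss (x : Fin n → EuclideanSpace ℝ (Fin d)) (y : Fin n → ℝ)
    (a : Fin m → ℝ) (W : Weights m d) (r : Fin m) (h : ∀ i, ⟪W r, x i⟫ ≠ 0) :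
    HasGradientAt (fun w => loss x y a (Function.update W r w)) (lossGrad x y a W r) (W r) := by
  classical
  have hnet : ∀ i, HasFDerivAt (fun w => net a (Function.update W r w) (x i))
      (((1 / √(m : ℝ)) * (a r * reluDeriv ⟪W r, x i⟫)) • innerSL ℝ (x i)) (W r) := by
    intro i
    have hin : HasFDerivAt (fun w : EuclideanSpace ℝ (Fin d) => ⟪w, x i⟫) (innerSL ℝ (x i))
        (W r) := by
      have := (innerSL ℝ (x i)).hasFDerivAt (x := W r)
      refine this.congr_of_eventuallyEq (Filter.Eventually.of_forall fun w => ?_)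
      simp [real_inner_comm]
    have h1 := ((hasDerivAt_relu (h i)).comp_hasFDerivAt (W r) hin).const_mul (a r)
    have h2 : HasFDerivAt (fun w => ∑ s, a s * relu ⟪Function.update W r w s, x i⟫)
        (∑ s, if s = r then a r • reluDeriv ⟪W r, x i⟫ • innerSL ℝ (x i) else 0) (W r) := by
      refine HasFDerivAt.fun_sum fun s _ => ?_
      by_cases hs : s = r
      · subst hs
        simpa using h1
      · simpa [hs] using hasFDerivAt_const (a s * relu ⟪W s, x i⟫) (W r)
    have h3 := h2.const_mul (1 / √(m : ℝ))
    simpa [net, mul_smul] using h3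
  rw [hasGradientAt_iff_hasFDerivAt]
  have h4 : HasFDerivAt (fun w => loss x y a (Function.update W r w))
      (∑ i, (net a W (x i) - y i) •
        (((1 / √(m : ℝ)) * (a r * reluDeriv ⟪W r, x i⟫)) • innerSL ℝ (x i))) (W r) := by
    refine HasFDerivAt.fun_sum fun i _ => ?_
    have h5 := (((hnet i).sub_const (y i)).pow 2).const_mul (1 / 2 : ℝ)
    refine h5.congr_fderiv ?_
    ext v
    simp
    ring
  refine h4.congr_fderiv ?_
  ext v
  simp [lossGrad, Finset.mul_sum]
  refine Finset.sum_congr rfl fun i _ => ?_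
  ring

end TwoLayer

end

/-!
Write `e(k)` for the vector of residuals `f(W(k), a, x_i) - y_i`, `H` for the limiting Gram matrix
`gramInf`, `λ₀` for its smallest eigenvalue and `H(0)` for the empirical Gram matrix of the
initialization (`gramEmp`).

As long as every weight vector stays within `R` of its initial value, a hidden unit can change its
activation at the input `x_i` only if `|⟨w_r(0), x_i⟩| ≤ R`. Hence a gradient step acts on the
residual as `I - η H(0)`, up to an error controlled by the fraction of units this close to their
kink (`abs_residual_step_le`). For `η ≤ c₂ / ‖H‖` with `c₂ < 2` the spectrum of `η H` lies in
`[η λ₀, c₂]`, so `‖I - η H‖ ≤ 1 - κ η λ₀` with `κ = (2 - c₂) / 2`, and if `‖H(0) - H‖_F` and the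
near-kink fraction are small compared with `κ λ₀`, a step contracts the residual by
`ρ = 1 - κ η λ₀ / 2` (`norm_residual_step_le`, `norm_residual_gd_le_of_good_init`).

A unit moves by at most `η √(n/m) ‖e(k)‖` in step `k`. Summing the geometric series, the total
displacement is at most `2 √(n/m) ‖e(0)‖ / (κ λ₀)`, which is below `R` for large `m`; this closes
the induction (`norm_residual_gd_le`).

It remains to bound three quantities at the initialization. Second moments and Markov's inequality
suffice: `‖e(0)‖² ≲ n / δ` (`initLaw_residual_ge_le`), `‖H(0) - H‖_F² ≲ n² / (m δ)`
(`initLaw_gramEmp_ge_le`), and a near-kink fraction, summed over the inputs, of at most `3 n R / δ`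
(`initLaw_nearKinkSum_ge_le`), each outside an event of probability `δ / 3`. With `R` of order
`λ₀ δ / n²` the displacement condition reads `m ≳ n⁶ / (λ₀⁴ δ³)`, and all conditions follow from the
assumed width. The number of steps then comes from `ρ ^ (2 T) ≤ exp (-κ η λ₀ T)`
(`half_sq_le_of_geometric_decay`).
-/

open MeasureTheory ProbabilityTheory
open scoped RealInnerProductSpace

noncomputable section

namespace TwoLayer

/-! ### Spectral bounds for the limiting Gram matrix -/

lemma isHermitian_gramInf {n d : ℕ} (x : Fin n → EuclideanSpace ℝ (Fin d)) :
    (gramInf x).IsHermitian := by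
  ext i j
  simp only [gramInf, Matrix.conjTranspose_apply, Matrix.of_apply, star_trivial,
    real_inner_comm (x i) (x j), and_comm]

lemma lamMin_le_eigenvalues {n : ℕ} {A : Matrix (Fin n) (Fin n) ℝ} (hA : A.IsHermitian)
    (i : Fin n) : lamMin A ≤ hA.eigenvalues i :=
  csInf_le Matrix.finite_real_spectrum.bddBelow (hA.eigenvalues_mem_spectrum_real i)

lemma eigenvalues_le_lamMax {n : ℕ} {A : Matrix (Fin n) (Fin n) ℝ} (hA : A.IsHermitian)
    (i : Fin n) : hA.eigenvalues i ≤ lamMax A :=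
  le_csSup Matrix.finite_real_spectrum.bddAbove (hA.eigenvalues_mem_spectrum_real i)

lemma lamMin_le_one {n : ℕ} {A : Matrix (Fin n) (Fin n) ℝ} (hA : A.IsHermitian) (hn : 0 < n)
    (hdiag : ∀ i, A i i ≤ 1) : lamMin A ≤ 1 := by
  have h1 : (n : ℝ) * lamMin A ≤ n := by
    calc (n : ℝ) * lamMin A = ∑ _i : Fin n, lamMin A := by simp
      _ ≤ ∑ i, hA.eigenvalues i := Finset.sum_le_sum fun i _ => lamMin_le_eigenvalues hA i
      _ = A.trace := by simpa using hA.trace_eq_sum_eigenvalues.symm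
      _ ≤ ∑ _i : Fin n, (1 : ℝ) := Finset.sum_le_sum fun i _ => hdiag i
      _ = n := by simp
  have hn' : (0 : ℝ) < n := by exact_mod_cast hn
  by_contra! h
  nlinarith

/-- If `|1 - η λ| ≤ c` for every eigenvalue `λ` of the symmetric matrix `A`, then `I - η A` has
operator norm at most `c`. -/
lemma norm_sub_smul_toEuclideanLin_le {n : ℕ} {A : Matrix (Fin n) (Fin n) ℝ}
    (hA : A.IsHermitian) {η c : ℝ} (hc : 0 ≤ c) (h : ∀ i, |1 - η * hA.eigenvalues i| ≤ c)
    (v : EuclideanSpace ℝ (Fin n)) : ‖v - η • Matrix.toEuclideanLin A v‖ ≤ c * ‖v‖ := by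
  set b := hA.eigenvectorBasis
  have hsym := Matrix.isSymmetric_toEuclideanLin_iff.mpr hA
  have hb : ∀ i, Matrix.toEuclideanLin A (b i) = hA.eigenvalues i • b i := by
    intro i
    ext j
    simpa using congrFun (hA.mulVec_eigenvectorBasis i) j
  have key : ∀ i, ⟪b i, v - η • Matrix.toEuclideanLin A v⟫ =
      (1 - η * hA.eigenvalues i) * ⟪b i, v⟫ := by
    intro i
    rw [inner_sub_right, real_inner_smul_right, ← hsym (b i) v, hb i, real_inner_smul_left]
    ring
  refine le_of_sq_le_sq ?_ (by positivity)
  rw [mul_pow, ← b.sum_sq_norm_inner_right, ← b.sum_sq_norm_inner_right v, Finset.mul_sum]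
  refine Finset.sum_le_sum fun i _ => ?_
  rw [key i, norm_mul, mul_pow]
  gcongr
  exact h i

lemma norm_toEuclideanLin_le {n : ℕ} (A : Matrix (Fin n) (Fin n) ℝ)
    (v : EuclideanSpace ℝ (Fin n)) :
    ‖Matrix.toEuclideanLin A v‖ ≤ √(∑ i, ∑ j, A i j ^ 2) * ‖v‖ := by
  rw [EuclideanSpace.norm_eq, EuclideanSpace.norm_eq, ← Real.sqrt_mul (by positivity)]
  refine Real.sqrt_le_sqrt ?_
  rw [Finset.sum_mul]
  refine Finset.sum_le_sum fun i _ => ?_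
  simpa [Matrix.mulVec, dotProduct] using
    Finset.sum_mul_sq_le_sq_mul_sq Finset.univ (A i) (fun j => v j)

lemma sum_abs_le_sqrt_mul_norm {n : ℕ} (v : EuclideanSpace ℝ (Fin n)) :
    ∑ j, |v j| ≤ √n * ‖v‖ := by
  have h := Finset.sum_mul_sq_le_sq_mul_sq Finset.univ (fun _ => (1 : ℝ)) (fun j => |v j|)
  rw [EuclideanSpace.norm_eq, ← Real.sqrt_mul (by positivity)]
  refine Real.le_sqrt_of_sq_le ?_
  simpa using h

lemma norm_le_sqrt_mul_of_forall_abs_le {n : ℕ} {v : EuclideanSpace ℝ (Fin n)} {c : ℝ}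
    (hc : 0 ≤ c) (h : ∀ i, |v i| ≤ c) : ‖v‖ ≤ √n * c := by
  rw [EuclideanSpace.norm_eq, ← Real.sqrt_sq hc, ← Real.sqrt_mul (by positivity)]
  refine Real.sqrt_le_sqrt ?_
  calc ∑ i, ‖v i‖ ^ 2 ≤ ∑ _i : Fin n, c ^ 2 := by
        refine Finset.sum_le_sum fun i _ => ?_
        have := h i
        rw [Real.norm_eq_abs]
        gcongr
    _ = n * c ^ 2 := by simp

/-! ### One step of gradient descent near the initialization -/

lemma reluDeriv_nonneg (z : ℝ) : 0 ≤ reluDeriv z := by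
  unfold reluDeriv; split_ifs <;> norm_num

lemma reluDeriv_le_one (z : ℝ) : reluDeriv z ≤ 1 := by
  unfold reluDeriv; split_ifs <;> norm_num

lemma abs_reluDeriv_le_one (z : ℝ) : |reluDeriv z| ≤ 1 := by
  rw [abs_of_nonneg (reluDeriv_nonneg z)]; exact reluDeriv_le_one z

lemma abs_relu_sub_relu_le (z w : ℝ) : |relu z - relu w| ≤ |z - w| :=
  abs_max_sub_max_le_abs z w 0

lemma relu_eq_reluDeriv_mul (z : ℝ) : relu z = reluDeriv z * z := by
  unfold relu reluDeriv
  split_ifs with h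
  · simp [h]
  · simp [(not_le.mp h).le]

/-- A preactivation of size larger than `R` keeps its sign when it moves by at most `R`. -/
lemma reluDeriv_eq_of_abs_sub_le {z z₀ R : ℝ} (h₀ : R < |z₀|) (h : |z - z₀| ≤ R) :
    reluDeriv z = reluDeriv z₀ := by
  have h1 := abs_le.mp h
  unfold reluDeriv
  rcases lt_abs.mp h₀ with h2 | h2
  · rw [if_pos (by linarith), if_pos (by linarith)]
  · rw [if_neg (by linarith), if_neg (by linarith)]

/-- The vector of residuals `f(W, a, x_i) - y_i`. -/
def residual {n m d : ℕ} (x : Fin n → EuclideanSpace ℝ (Fin d)) (y : Fin n → ℝ) (a : Fin m → ℝ)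
    (W : Weights m d) : EuclideanSpace ℝ (Fin n) :=
  WithLp.toLp 2 fun i => net a W (x i) - y i

/-- The empirical Gram matrix `(1/m) ∑_r ⟨x_i, x_j⟩ 𝟙{⟨w_r, x_i⟩ ≥ 0} 𝟙{⟨w_r, x_j⟩ ≥ 0}`. -/
def gramEmp {n m d : ℕ} (x : Fin n → EuclideanSpace ℝ (Fin d)) (W : Weights m d) :
    Matrix (Fin n) (Fin n) ℝ :=
  Matrix.of fun i j =>
    (1 / (m : ℝ)) * ∑ r, ⟪x i, x j⟫ * (reluDeriv ⟪W r, x i⟫ * reluDeriv ⟪W r, x j⟫)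

/-- The indicator that the unit with weights `w` is within `R` of its kink at the input `z`. -/
def nearKink {d : ℕ} (R : ℝ) (w z : EuclideanSpace ℝ (Fin d)) : ℝ :=
  if |⟪w, z⟫| ≤ R then 1 else 0

/-- The fraction of hidden units within `R` of their kink, summed over the inputs. -/
def nearKinkSum {n m d : ℕ} (x : Fin n → EuclideanSpace ℝ (Fin d)) (R : ℝ) (W : Weights m d) :
    ℝ :=
  ∑ i, (1 / (m : ℝ)) * ∑ r, nearKink R (W r) (x i)

lemma nearKink_nonneg {d : ℕ} (R : ℝ) (w z : EuclideanSpace ℝ (Fin d)) : 0 ≤ nearKink R w z := by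
  unfold nearKink; split_ifs <;> norm_num

lemma loss_eq {n m d : ℕ} (x : Fin n → EuclideanSpace ℝ (Fin d)) (y : Fin n → ℝ)
    (a : Fin m → ℝ) (W : Weights m d) : loss x y a W = 1 / 2 * ‖residual x y a W‖ ^ 2 := by
  simp [EuclideanSpace.norm_sq_eq, residual, loss, Finset.mul_sum]

lemma abs_inner_le_one {d : ℕ} {u v : EuclideanSpace ℝ (Fin d)} (hu : ‖u‖ = 1) (hv : ‖v‖ = 1) :
    |⟪u, v⟫| ≤ 1 := by
  simpa [hu, hv] using abs_real_inner_le_norm u v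

lemma abs_inner_sub_inner_le {d : ℕ} {u v z : EuclideanSpace ℝ (Fin d)} (hz : ‖z‖ = 1) :
    |⟪u, z⟫ - ⟪v, z⟫| ≤ ‖u - v‖ := by
  rw [← inner_sub_left]
  simpa [hz] using abs_real_inner_le_norm (u - v) z

/-- The gradient in a single hidden unit has norm at most `√(n/m) ‖e‖`, where `e` is the residual. -/
lemma norm_lossGrad_le {n m d : ℕ} {x : Fin n → EuclideanSpace ℝ (Fin d)} (hx : ∀ i, ‖x i‖ = 1)
    (y : Fin n → ℝ) {a : Fin m → ℝ} (ha : ∀ r, |a r| = 1) (W : Weights m d) (r : Fin m) :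
    ‖lossGrad x y a W r‖ ≤ 1 / √m * (√n * ‖residual x y a W‖) := by
  unfold lossGrad
  rw [norm_smul, Real.norm_of_nonneg (by positivity)]
  gcongr
  refine le_trans (norm_sum_le _ _) (le_trans (Finset.sum_le_sum fun i _ => ?_)
    (sum_abs_le_sqrt_mul_norm (residual x y a W)))
  rw [norm_smul, hx i, mul_one, Real.norm_eq_abs, abs_mul, abs_mul, ha r, mul_one]
  exact mul_le_of_le_one_right (abs_nonneg _) (abs_reluDeriv_le_one _)

/-- The change of the output of a single unit in one gradient step, compared with its linearization
at the initial activation pattern. Here `z₀`, `z`, `z'` are the preactivations at the initialization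
and before and after the step, and `p`, `q` are the sums over the data that enter the gradient with
the current and with the initial activation pattern. -/
lemma abs_unit_step_le {z₀ z z' R c α p q S X : ℝ} (hα : |α| = 1) (hc : 0 ≤ c)
    (hstep : z' - z = -(c * α * p)) (hz : |z - z₀| ≤ R) (hz' : |z' - z₀| ≤ R)
    (hp : |p| ≤ S) (hq : |q| ≤ S) (hpq : |q - p| ≤ X) (hX : 0 ≤ X) :
    |α * (relu z' - relu z) + c * (reluDeriv z₀ * q)| ≤
      c * (X + 2 * S * (if |z₀| ≤ R then 1 else 0)) := by
  have hα2 : α ^ 2 = 1 := by rw [← sq_abs, hα, one_pow]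
  have hb := abs_reluDeriv_le_one z₀
  split_ifs with h
  · calc |α * (relu z' - relu z) + c * (reluDeriv z₀ * q)|
        ≤ |α * (relu z' - relu z)| + |c * (reluDeriv z₀ * q)| := abs_add_le _ _
      _ = |relu z' - relu z| + c * (|reluDeriv z₀| * |q|) := by
          rw [abs_mul, hα, one_mul, abs_mul c, abs_of_nonneg hc, abs_mul]
      _ ≤ |z' - z| + c * (1 * S) := by
          refine add_le_add (abs_relu_sub_relu_le _ _) ?_
          gcongr
      _ = c * |p| + c * (1 * S) := by
          rw [hstep, abs_neg, abs_mul, abs_mul, hα, abs_of_nonneg hc, mul_one]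
      _ ≤ c * S + c * (1 * S) := by gcongr
      _ ≤ c * (X + 2 * S * 1) := by nlinarith
  · rw [not_le] at h
    have e : α * (relu z' - relu z) + c * (reluDeriv z₀ * q) = c * (reluDeriv z₀ * (q - p)) := by
      rw [relu_eq_reluDeriv_mul z', relu_eq_reluDeriv_mul z, reluDeriv_eq_of_abs_sub_le h hz,
        reluDeriv_eq_of_abs_sub_le h hz', ← mul_sub, hstep]
      linear_combination (-(reluDeriv z₀ * c * p)) * hα2
    rw [e, abs_mul, abs_of_nonneg hc, abs_mul]
    gcongr
    calc |reluDeriv z₀| * |q - p| ≤ 1 * X := by gcongr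
      _ = X + 2 * S * 0 := by ring

/-- One gradient step near the initialization acts on the residual `e` as the linear map `I - η H(0)`,
entrywise up to `3 η N ∑_j |e_j|` with `N = nearKinkSum x R W₀`. The error has two sources: units near
their kink at `x_i`, whose output need not be linear along the step, and units near their kink at
some `x_j`, which may enter the gradient differently than at the initialization. -/
lemma abs_residual_step_le {n m d : ℕ} {x : Fin n → EuclideanSpace ℝ (Fin d)}
    (hx : ∀ i, ‖x i‖ = 1) (y : Fin n → ℝ) {a : Fin m → ℝ} (ha : ∀ r, |a r| = 1) {η R : ℝ}
    (hη : 0 ≤ η) {W₀ W W' : Weights m d} (hstep : ∀ r, W' r = W r - η • lossGrad x y a W r)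
    (hW : ∀ r, ‖W r - W₀ r‖ ≤ R) (hW' : ∀ r, ‖W' r - W₀ r‖ ≤ R) (i : Fin n) :
    |residual x y a W' i - residual x y a W i
        + η * Matrix.toEuclideanLin (gramEmp x W₀) (residual x y a W) i| ≤
      3 * (η * nearKinkSum x R W₀) * ∑ j, |residual x y a W j| := by
  set e := residual x y a W with he
  set S := ∑ j, |e j| with hS
  have hS0 : 0 ≤ S := Finset.sum_nonneg fun _ _ => abs_nonneg _
  set q : Fin m → ℝ := fun r => ∑ j, e j * reluDeriv ⟪W₀ r, x j⟫ * ⟪x i, x j⟫ with hq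
  set p : Fin m → ℝ := fun r => ∑ j, e j * reluDeriv ⟪W r, x j⟫ * ⟪x i, x j⟫ with hp
  set X : Fin m → ℝ := fun r => ∑ j, |e j| * nearKink R (W₀ r) (x j) with hXdef
  have hbd : ∀ (V : Weights m d) r, |∑ j, e j * reluDeriv ⟪V r, x j⟫ * ⟪x i, x j⟫| ≤ S := by
    intro V r
    refine (Finset.abs_sum_le_sum_abs _ _).trans (Finset.sum_le_sum fun j _ => ?_)
    rw [abs_mul, abs_mul, mul_assoc]
    refine mul_le_of_le_one_right (abs_nonneg _) ?_
    exact mul_le_one₀ (abs_reluDeriv_le_one _) (abs_nonneg _) (abs_inner_le_one (hx i) (hx j))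
  have hqp : ∀ r, |q r - p r| ≤ X r := by
    intro r
    rw [hq, hp, hXdef]
    simp only
    rw [← Finset.sum_sub_distrib]
    refine (Finset.abs_sum_le_sum_abs _ _).trans (Finset.sum_le_sum fun j _ => ?_)
    have e1 : e j * reluDeriv ⟪W₀ r, x j⟫ * ⟪x i, x j⟫ - e j * reluDeriv ⟪W r, x j⟫ * ⟪x i, x j⟫
        = e j * ((reluDeriv ⟪W₀ r, x j⟫ - reluDeriv ⟪W r, x j⟫) * ⟪x i, x j⟫) := by ring
    rw [e1, abs_mul, abs_mul]
    refine mul_le_mul_of_nonneg_left ?_ (abs_nonneg _)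
    refine (mul_le_of_le_one_right (abs_nonneg _) (abs_inner_le_one (hx i) (hx j))).trans ?_
    unfold nearKink
    split_ifs with h
    · rw [abs_le]
      constructor <;> linarith [reluDeriv_nonneg ⟪W₀ r, x j⟫, reluDeriv_le_one ⟪W₀ r, x j⟫,
        reluDeriv_nonneg ⟪W r, x j⟫, reluDeriv_le_one ⟪W r, x j⟫]
    · rw [reluDeriv_eq_of_abs_sub_le (not_le.mp h)
        ((abs_inner_sub_inner_le (hx j)).trans (hW r)), sub_self, abs_zero]
  have hdiff : ∀ r, ⟪W' r, x i⟫ - ⟪W r, x i⟫ = -(η * (1 / √m) * a r * p r) := by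
    intro r
    rw [hstep r, inner_sub_left, real_inner_smul_left, lossGrad, real_inner_smul_left, sum_inner]
    have : ∑ j, ⟪((net a W (x j) - y j) * a r * reluDeriv ⟪W r, x j⟫) • x j, x i⟫
        = a r * p r := by
      rw [hp, Finset.mul_sum]
      refine Finset.sum_congr rfl fun j _ => ?_
      rw [real_inner_smul_left, real_inner_comm (x i) (x j), he]
      simp only [residual]
      ring
    rw [this]; ring
  have hunit : ∀ r, |a r * (relu ⟪W' r, x i⟫ - relu ⟪W r, x i⟫)
      + η * (1 / √m) * (reluDeriv ⟪W₀ r, x i⟫ * q r)| ≤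
      η * (1 / √m) * (X r + 2 * S * nearKink R (W₀ r) (x i)) := fun r =>
    abs_unit_step_le (ha r) (by positivity) (hdiff r)
      ((abs_inner_sub_inner_le (hx i)).trans (hW r))
      ((abs_inner_sub_inner_le (hx i)).trans (hW' r)) (hbd W r) (hbd W₀ r) (hqp r)
      (Finset.sum_nonneg fun j _ => mul_nonneg (abs_nonneg _) (nearKink_nonneg _ _ _))
  have hm : (1 / √(m : ℝ)) * (1 / √m) = 1 / m := by
    rw [div_mul_div_comm, one_mul, Real.mul_self_sqrt (Nat.cast_nonneg m)]
  have hexp : residual x y a W' i - e i + η * Matrix.toEuclideanLin (gramEmp x W₀) e i =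
      1 / √m * ∑ r, (a r * (relu ⟪W' r, x i⟫ - relu ⟪W r, x i⟫)
        + η * (1 / √m) * (reluDeriv ⟪W₀ r, x i⟫ * q r)) := by
    have h1 : Matrix.toEuclideanLin (gramEmp x W₀) e i =
        1 / m * ∑ r, reluDeriv ⟪W₀ r, x i⟫ * q r := by
      simp only [Matrix.toLpLin_apply, Matrix.mulVec, dotProduct, gramEmp,
        Matrix.of_apply, hq, Finset.mul_sum, Finset.sum_mul]
      rw [Finset.sum_comm]
      refine Finset.sum_congr rfl fun r _ => Finset.sum_congr rfl fun j _ => ?_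
      ring
    rw [h1, Finset.sum_add_distrib, ← Finset.mul_sum, ← hm, he]
    simp only [residual, net, mul_sub, Finset.sum_sub_distrib]
    ring
  rw [hexp, abs_mul, abs_of_nonneg (by positivity : 0 ≤ 1 / √(m : ℝ))]
  set N : Fin n → ℝ := fun j => 1 / (m : ℝ) * ∑ r, nearKink R (W₀ r) (x j) with hN
  have hN0 : ∀ j, 0 ≤ N j := fun j =>
    mul_nonneg (by positivity) (Finset.sum_nonneg fun _ _ => nearKink_nonneg _ _ _)
  have hNle : ∀ j, N j ≤ nearKinkSum x R W₀ := fun j =>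
    Finset.single_le_sum (f := N) (fun j _ => hN0 j) (Finset.mem_univ j)
  have hXsum : 1 / (m : ℝ) * ∑ r, X r = ∑ j, |e j| * N j := by
    simp only [hXdef, hN, Finset.mul_sum]
    rw [Finset.sum_comm]
    refine Finset.sum_congr rfl fun r _ => Finset.sum_congr rfl fun j _ => ?_
    ring
  calc 1 / √m * |∑ r, (a r * (relu ⟪W' r, x i⟫ - relu ⟪W r, x i⟫)
          + η * (1 / √m) * (reluDeriv ⟪W₀ r, x i⟫ * q r))|
      ≤ 1 / √m * ∑ r, η * (1 / √m) * (X r + 2 * S * nearKink R (W₀ r) (x i)) := by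
        gcongr
        exact (Finset.abs_sum_le_sum_abs _ _).trans (Finset.sum_le_sum fun r _ => hunit r)
    _ = η * (1 / m * ∑ r, X r + 2 * S * N i) := by
        rw [← Finset.mul_sum, Finset.sum_add_distrib, ← Finset.mul_sum, hN, ← hm]
        ring
    _ ≤ η * (∑ j, |e j| * nearKinkSum x R W₀ + 2 * S * nearKinkSum x R W₀) := by
        rw [hXsum]
        gcongr with j
        · exact hNle j
        · exact hNle i
    _ = 3 * (η * nearKinkSum x R W₀) * S := by
        rw [← Finset.sum_mul]; ring

/-- One gradient step near the initialization contracts the residual, provided that `I - η H` is a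
contraction and that both `‖H(0) - H‖_F` and the number of near-kink units are small. -/
lemma norm_residual_step_le {n m d : ℕ} {x : Fin n → EuclideanSpace ℝ (Fin d)}
    (hx : ∀ i, ‖x i‖ = 1) (y : Fin n → ℝ) {a : Fin m → ℝ} (ha : ∀ r, |a r| = 1) {η R c F : ℝ}
    (hη : 0 ≤ η) {W₀ W W' : Weights m d} (hstep : ∀ r, W' r = W r - η • lossGrad x y a W r)
    (hW : ∀ r, ‖W r - W₀ r‖ ≤ R) (hW' : ∀ r, ‖W' r - W₀ r‖ ≤ R)
    {H : Matrix (Fin n) (Fin n) ℝ}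
    (hc : ∀ v : EuclideanSpace ℝ (Fin n), ‖v - η • Matrix.toEuclideanLin H v‖ ≤ c * ‖v‖)
    (hF : ∑ i, ∑ j, (gramEmp x W₀ i j - H i j) ^ 2 ≤ F ^ 2) (hF0 : 0 ≤ F) :
    ‖residual x y a W'‖ ≤
      (c + η * F + 3 * η * n * nearKinkSum x R W₀) * ‖residual x y a W‖ := by
  set e := residual x y a W with he
  set G := gramEmp x W₀ with hG
  have hN : 0 ≤ nearKinkSum x R W₀ := Finset.sum_nonneg fun j _ =>
    mul_nonneg (by positivity) (Finset.sum_nonneg fun _ _ => nearKink_nonneg _ _ _)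
  set ζ := residual x y a W' - e + η • Matrix.toEuclideanLin G e with hζ
  have h1 : ‖ζ‖ ≤ √n * (3 * (η * nearKinkSum x R W₀) * (√n * ‖e‖)) := by
    refine norm_le_sqrt_mul_of_forall_abs_le (by positivity) fun i => ?_
    refine (abs_residual_step_le hx y ha hη hstep hW hW' i).trans ?_
    gcongr
    exact sum_abs_le_sqrt_mul_norm _
  have h2 : ‖Matrix.toEuclideanLin (G - H) e‖ ≤ F * ‖e‖ := by
    refine (norm_toEuclideanLin_le _ _).trans ?_
    gcongr
    exact (Real.sqrt_le_sqrt hF).trans_eq (Real.sqrt_sq hF0)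
  have h3 : residual x y a W' =
      (e - η • Matrix.toEuclideanLin H e) - η • Matrix.toEuclideanLin (G - H) e + ζ := by
    rw [hζ, map_sub, LinearMap.sub_apply, smul_sub]
    abel
  have hn : √(n : ℝ) * √n = n := Real.mul_self_sqrt (Nat.cast_nonneg n)
  calc ‖residual x y a W'‖
      ≤ ‖e - η • Matrix.toEuclideanLin H e‖ + ‖η • Matrix.toEuclideanLin (G - H) e‖ + ‖ζ‖ := by
        rw [h3]
        exact (norm_add_le _ _).trans (add_le_add_left (norm_sub_le _ _) _)
    _ ≤ c * ‖e‖ + η * (F * ‖e‖) + √n * (3 * (η * nearKinkSum x R W₀) * (√n * ‖e‖)) := by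
        rw [norm_smul, Real.norm_of_nonneg hη]
        gcongr
        exact hc e
    _ = (c + η * F + 3 * η * n * nearKinkSum x R W₀) * ‖e‖ := by
        linear_combination (3 * (η * nearKinkSum x R W₀) * ‖e‖) * hn

/-! ### Linear convergence from a good initialization -/

/-- If every step that starts and ends within `R` of the initialization contracts the residual by
`ρ`, and `R` exceeds the total length `η √(n/m) ‖e(0)‖ / (1 - ρ)` of such a trajectory, then the
trajectory never leaves this neighbourhood and the residual decays geometrically. The quantity
`‖w_r(k) - w_r(0)‖ + η √(n/m) ‖e(k)‖ / (1 - ρ)` is nonincreasing in `k`. -/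
lemma norm_residual_gd_le {n m d : ℕ} {x : Fin n → EuclideanSpace ℝ (Fin d)}
    (hx : ∀ i, ‖x i‖ = 1) (y : Fin n → ℝ) {a : Fin m → ℝ} (ha : ∀ r, |a r| = 1) {η R ρ M : ℝ}
    (hη : 0 ≤ η) (hρ : 0 ≤ ρ) (hM : η * (1 / √m * √n) + M * ρ = M) (hM0 : 0 ≤ M)
    {W₀ : Weights m d} (hR : M * ‖residual x y a W₀‖ ≤ R)
    (hcontr : ∀ W W' : Weights m d, (∀ r, W' r = W r - η • lossGrad x y a W r) →
      (∀ r, ‖W r - W₀ r‖ ≤ R) → (∀ r, ‖W' r - W₀ r‖ ≤ R) →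
      ‖residual x y a W'‖ ≤ ρ * ‖residual x y a W‖) (k : ℕ) :
    (∀ r, ‖gd x y η a W₀ k r - W₀ r‖ + M * ‖residual x y a (gd x y η a W₀ k)‖
        ≤ M * ‖residual x y a W₀‖) ∧
      ‖residual x y a (gd x y η a W₀ k)‖ ≤ ρ ^ k * ‖residual x y a W₀‖ := by
  induction k with
  | zero => simp [gd]
  | succ k ih =>
    obtain ⟨ih1, ih2⟩ := ih
    set W := gd x y η a W₀ k
    set W' := gd x y η a W₀ (k + 1)
    have hstep : ∀ r, W' r = W r - η • lossGrad x y a W r := fun r => rfl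
    have hmove : ∀ r, ‖W' r - W₀ r‖ ≤
        ‖W r - W₀ r‖ + η * (1 / √m * √n) * ‖residual x y a W‖ := by
      intro r
      have e1 : W' r - W₀ r = (W r - W₀ r) - η • lossGrad x y a W r := by rw [hstep r]; abel
      rw [e1]
      refine (norm_sub_le _ _).trans (add_le_add le_rfl ?_)
      rw [norm_smul, Real.norm_of_nonneg hη, mul_assoc, mul_assoc]
      gcongr
      exact norm_lossGrad_le hx y ha W r
    have hW : ∀ r, ‖W r - W₀ r‖ ≤ R := fun r => by
      have := ih1 r
      have : 0 ≤ M * ‖residual x y a W‖ := by positivity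
      linarith
    have hW' : ∀ r, ‖W' r - W₀ r‖ ≤ R := fun r => by
      have h1 := ih1 r
      have h2 := hmove r
      have h3 : 0 ≤ M * ρ * ‖residual x y a W‖ := by positivity
      have h4 : η * (1 / √m * √n) * ‖residual x y a W‖ + M * ρ * ‖residual x y a W‖
          = M * ‖residual x y a W‖ := by rw [← add_mul, hM]
      linarith
    have hc := hcontr W W' hstep hW hW'
    refine ⟨fun r => ?_, ?_⟩
    · have h1 := ih1 r
      have h2 := hmove r
      have h3 : M * ‖residual x y a W'‖ ≤ M * (ρ * ‖residual x y a W‖) := by gcongr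
      have h4 : η * (1 / √m * √n) * ‖residual x y a W‖ + M * ρ * ‖residual x y a W‖
          = M * ‖residual x y a W‖ := by rw [← add_mul, hM]
      linarith
    · calc ‖residual x y a W'‖ ≤ ρ * ‖residual x y a W‖ := hc
        _ ≤ ρ * (ρ ^ k * ‖residual x y a W₀‖) := by gcongr
        _ = ρ ^ (k + 1) * ‖residual x y a W₀‖ := by ring

/-! ### Second moments of the random initialization -/

/-- Markov's inequality for a real-valued function. -/
lemma measure_ge_le_ofReal_div {Ω : Type*} [MeasurableSpace Ω] {μ : Measure Ω} {f : Ω → ℝ}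
    (hf : Measurable f) {c t : ℝ} (hc : ∫⁻ ω, ENNReal.ofReal (f ω) ∂μ ≤ ENNReal.ofReal c)
    (ht : 0 < t) : μ {ω | t ≤ f ω} ≤ ENNReal.ofReal (c / t) := by
  have h1 : {ω | t ≤ f ω} ⊆ {ω | ENNReal.ofReal t ≤ ENNReal.ofReal (f ω)} :=
    fun ω h => ENNReal.ofReal_le_ofReal h
  refine (measure_mono h1).trans ?_
  refine (meas_ge_le_lintegral_div hf.ennreal_ofReal.aemeasurable
    (by simpa using ht) ENNReal.ofReal_ne_top).trans ?_
  rw [ENNReal.ofReal_div_of_pos ht]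
  gcongr

/-- The mean square deviation of a sum of independent variables is the sum of their variances. -/
lemma lintegral_sq_sum_pi_sub {ι Ω : Type*} [Fintype ι] [MeasurableSpace Ω] {μ : Measure Ω}
    [IsProbabilityMeasure μ] {X : ι → Ω → ℝ} (hX : ∀ i, MemLp (X i) 2 μ) :
    ∫⁻ ω, ENNReal.ofReal ((∑ i, X i (ω i) - ∑ i, ∫ w, X i w ∂μ) ^ 2) ∂(Measure.pi fun _ => μ) =
      ENNReal.ofReal (∑ i, Var[X i; μ]) := by
  have hmem : ∀ i, MemLp (fun ω : ι → Ω => X i (ω i)) 2 (Measure.pi fun _ => μ) := fun i =>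
    (hX i).comp_measurePreserving (measurePreserving_eval _ i)
  have hY : MemLp (∑ i, fun ω : ι → Ω => X i (ω i)) 2 (Measure.pi fun _ => μ) :=
    memLp_finsetSum' _ fun i _ => hmem i
  have hmean : ∫ ω, (∑ i, fun ω : ι → Ω => X i (ω i)) ω ∂(Measure.pi fun _ => μ) =
      ∑ i, ∫ w, X i w ∂μ := by
    simp only [Finset.sum_apply]
    rw [integral_finsetSum _ fun i _ => (hmem i).integrable one_le_two]
    refine Finset.sum_congr rfl fun i _ => ?_
    exact integral_comp_eval (μ := fun _ : ι => μ) (hX i).aestronglyMeasurable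
  rw [← variance_sum_pi (μ := fun _ : ι => μ) hX, hY.ofReal_variance_eq,
    evariance_eq_lintegral_ofReal, hmean]
  simp only [Finset.sum_apply]

lemma measurable_relu : Measurable relu := measurable_id.max measurable_const

lemma measurable_reluDeriv : Measurable reluDeriv :=
  Measurable.ite measurableSet_Ici measurable_const measurable_const

lemma relu_sq_le (z : ℝ) : relu z ^ 2 ≤ z ^ 2 := by
  unfold relu
  rcases le_total z 0 with h | h
  · rw [max_eq_right h]; nlinarith
  · rw [max_eq_left h]

/-- For a unit vector `z` and `w ∼ N(0, I)`, the projection `⟨w, z⟩` is standard Gaussian. -/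
lemma map_inner_stdGaussian {d : ℕ} {z : EuclideanSpace ℝ (Fin d)} (hz : ‖z‖ = 1) :
    (stdGaussian (EuclideanSpace ℝ (Fin d))).map (fun w => ⟪w, z⟫) = gaussianReal 0 1 := by
  have h := IsGaussian.map_eq_gaussianReal (μ := stdGaussian (EuclideanSpace ℝ (Fin d)))
    (innerSL ℝ z)
  rw [integral_strongDual_stdGaussian, variance_dual_stdGaussian, innerSL_apply_norm, hz] at h
  have e : (fun w : EuclideanSpace ℝ (Fin d) => ⟪w, z⟫) = innerSL ℝ z := by
    ext w; rw [innerSL_apply_apply, real_inner_comm]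
  rw [e, h]
  simp

/-- The standard Gaussian density is at most `1/2`, so an interval of length `2R` has mass at most
`R`. -/
lemma gaussianReal_Icc_le (R : ℝ) :
    gaussianReal 0 1 (Set.Icc (-R) R) ≤ ENNReal.ofReal R := by
  rw [gaussianReal_apply 0 one_ne_zero]
  have hpdf : ∀ t, gaussianPDF 0 1 t ≤ ENNReal.ofReal (1 / 2) := by
    intro t
    refine ENNReal.ofReal_le_ofReal ?_
    unfold gaussianPDFReal
    have h2 : (2 : ℝ) ≤ √(2 * Real.pi * ((1 : NNReal) : ℝ)) := by
      refine Real.le_sqrt_of_sq_le ?_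
      have := Real.pi_gt_three
      norm_num
      linarith
    calc (√(2 * Real.pi * ((1 : NNReal) : ℝ)))⁻¹
          * Real.exp (-(t - 0) ^ 2 / (2 * ((1 : NNReal) : ℝ)))
        ≤ 2⁻¹ * 1 := by
          gcongr
          refine Real.exp_le_one_iff.mpr ?_
          exact div_nonpos_of_nonpos_of_nonneg (neg_nonpos.mpr (sq_nonneg _)) (by positivity)
      _ = 1 / 2 := by norm_num
  calc ∫⁻ t in Set.Icc (-R) R, gaussianPDF 0 1 t
      ≤ ∫⁻ _t in Set.Icc (-R) R, ENNReal.ofReal (1 / 2) := lintegral_mono fun t => hpdf t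
    _ = ENNReal.ofReal R := by
        rw [setLIntegral_const, Real.volume_Icc, ← ENNReal.ofReal_mul (by norm_num)]
        congr 1; ring

lemma measurable_nearKink {d : ℕ} (R : ℝ) (z : EuclideanSpace ℝ (Fin d)) :
    Measurable fun w => nearKink R w z :=
  Measurable.ite (measurableSet_le (by fun_prop) measurable_const) measurable_const
    measurable_const

lemma lintegral_nearKink_le {d : ℕ} (R : ℝ) {z : EuclideanSpace ℝ (Fin d)}
    (hz : ‖z‖ = 1) :
    ∫⁻ w, ENNReal.ofReal (nearKink R w z) ∂(stdGaussian (EuclideanSpace ℝ (Fin d))) ≤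
      ENNReal.ofReal R := by
  have hs : MeasurableSet ((fun w : EuclideanSpace ℝ (Fin d) => ⟪w, z⟫) ⁻¹' Set.Icc (-R) R) :=
    measurableSet_Icc.preimage (by fun_prop)
  have e : ∀ w : EuclideanSpace ℝ (Fin d), ENNReal.ofReal (nearKink R w z) =
      ((fun w : EuclideanSpace ℝ (Fin d) => ⟪w, z⟫) ⁻¹' Set.Icc (-R) R).indicator 1 w := by
    intro w
    by_cases h : |⟪w, z⟫| ≤ R
    · have h' := abs_le.mp h
      simp [nearKink, Set.indicator, h, h']
    · have h' : ¬ (-R ≤ ⟪w, z⟫ ∧ ⟪w, z⟫ ≤ R) := fun h' => h (abs_le.mpr h')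
      simp [nearKink, Set.indicator, h, h']
  simp_rw [e]
  rw [lintegral_indicator_one hs, ← Measure.map_apply (by fun_prop) measurableSet_Icc,
    map_inner_stdGaussian hz]
  exact gaussianReal_Icc_le R

lemma lintegral_inner_sq {d : ℕ} {z : EuclideanSpace ℝ (Fin d)} (hz : ‖z‖ = 1) :
    ∫⁻ w, ENNReal.ofReal (⟪w, z⟫ ^ 2) ∂(stdGaussian (EuclideanSpace ℝ (Fin d))) = 1 := by
  have h : ∫⁻ t, ENNReal.ofReal (t ^ 2) ∂(gaussianReal 0 1) = 1 := by
    have h1 := evariance_eq_lintegral_ofReal (id : ℝ → ℝ) (gaussianReal 0 1)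
    rw [← (memLp_id_gaussianReal' 2 (by norm_num)).ofReal_variance_eq,
      variance_id_gaussianReal] at h1
    simpa using h1.symm
  rw [← map_inner_stdGaussian hz, lintegral_map (by fun_prop) (by fun_prop)] at h
  exact h

/-! ### The random signs -/

instance isProbabilityMeasure_uniformOn_signs :
    IsProbabilityMeasure (uniformOn ({-1, 1} : Set ℝ)) :=
  isProbabilityMeasure_uniformOn (by simp) (by simp)

lemma ae_abs_eq_one_uniformOn_signs : ∀ᵐ s ∂(uniformOn ({-1, 1} : Set ℝ)), |s| = 1 := by
  have h : ∀ᵐ s ∂(uniformOn ({-1, 1} : Set ℝ)), s ∈ ({-1, 1} : Set ℝ) :=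
    ae_cond_mem (Set.toFinite _).measurableSet
  filter_upwards [h] with s hs
  rcases hs with rfl | rfl <;> norm_num

lemma integral_id_uniformOn_signs : ∫ s, s ∂(uniformOn ({-1, 1} : Set ℝ)) = 0 := by
  have e : ({-1, 1} : Set ℝ) = (({-1, 1} : Finset ℝ) : Set ℝ) := by simp
  have hi : IntegrableOn (fun s : ℝ => s) (({-1, 1} : Finset ℝ) : Set ℝ) Measure.count :=
    Measure.integrableOn_of_bounded (M := 1) (Measure.count_apply_lt_top.mpr
      (Finset.finite_toSet _)).ne measurable_id.aestronglyMeasurable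
      ((ae_restrict_mem (Finset.measurableSet _)).mono fun s hs => by
        rw [← e] at hs
        rcases hs with rfl | rfl <;> norm_num)
  rw [uniformOn, ProbabilityTheory.cond, integral_smul_measure, e, setIntegral_finset _ hi,
    Finset.sum_pair (by norm_num)]
  simp [measureReal_def]

lemma memLp_id_uniformOn_signs : MemLp (fun s : ℝ => s) 2 (uniformOn ({-1, 1} : Set ℝ)) :=
  MemLp.of_bound measurable_id.aestronglyMeasurable 1
    (ae_abs_eq_one_uniformOn_signs.mono fun s hs => by rw [Real.norm_eq_abs, hs])

/-- A Rademacher sum has second moment at most the sum of the squared coefficients. -/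
lemma lintegral_sq_sum_signs_le {m : ℕ} (c : Fin m → ℝ) :
    ∫⁻ a, ENNReal.ofReal ((∑ r, a r * c r) ^ 2)
        ∂(Measure.pi fun _ : Fin m => uniformOn ({-1, 1} : Set ℝ)) ≤
      ∑ r, ENNReal.ofReal (c r ^ 2) := by
  have h := lintegral_sq_sum_pi_sub (μ := uniformOn ({-1, 1} : Set ℝ))
    (X := fun r s => s * c r) (fun r => memLp_id_uniformOn_signs.mul_const (c r))
  simp only [integral_mul_const, integral_id_uniformOn_signs, zero_mul, Finset.sum_const_zero,
    sub_zero] at h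
  rw [h, ← ENNReal.ofReal_sum_of_nonneg fun r _ => sq_nonneg _]
  refine ENNReal.ofReal_le_ofReal (Finset.sum_le_sum fun r _ => ?_)
  refine (variance_le_expectation_sq (by fun_prop)).trans ?_
  have e : ∫ s, ((fun s => s * c r) ^ 2) s ∂(uniformOn ({-1, 1} : Set ℝ)) =
      ∫ _s, c r ^ 2 ∂(uniformOn ({-1, 1} : Set ℝ)) := by
    refine integral_congr_ae (ae_abs_eq_one_uniformOn_signs.mono fun s hs => ?_)
    simp only [Pi.pow_apply]
    rw [mul_pow, ← sq_abs s, hs, one_pow, one_mul]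
  rw [e]
  simp

/-! ### Good events for the initialization -/

instance isProbabilityMeasure_initLaw (m d : ℕ) : IsProbabilityMeasure (initLaw m d) := by
  unfold initLaw; infer_instance

lemma ae_abs_eq_one_initLaw (m d : ℕ) : ∀ᵐ p ∂(initLaw m d), ∀ r, |p.2 r| = 1 := by
  have h : ∀ᵐ a ∂(Measure.pi fun _ : Fin m => uniformOn ({-1, 1} : Set ℝ)), ∀ r, |a r| = 1 :=
    ae_all_iff.mpr fun r =>
      (measurePreserving_eval (fun _ : Fin m => uniformOn ({-1, 1} : Set ℝ))
        r).quasiMeasurePreserving.ae ae_abs_eq_one_uniformOn_signs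
  exact measurePreserving_snd.quasiMeasurePreserving.ae h

lemma lintegral_initLaw_fst {m d : ℕ} {f : Weights m d → ENNReal} (hf : Measurable f) :
    ∫⁻ p, f p.1 ∂(initLaw m d) =
      ∫⁻ W, f W ∂(Measure.pi fun _ : Fin m => stdGaussian (EuclideanSpace ℝ (Fin d))) :=
  measurePreserving_fst.lintegral_comp hf

lemma lintegral_pi_sum {m d : ℕ} {g : EuclideanSpace ℝ (Fin d) → ENNReal} (hg : Measurable g) :
    ∫⁻ W, ∑ r, g (W r) ∂(Measure.pi fun _ : Fin m => stdGaussian (EuclideanSpace ℝ (Fin d))) =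
      m * ∫⁻ w, g w ∂(stdGaussian (EuclideanSpace ℝ (Fin d))) := by
  rw [lintegral_finsetSum _ fun r _ => by fun_prop]
  have h : ∀ r : Fin m, ∫⁻ W : Fin m → EuclideanSpace ℝ (Fin d), g (W r)
      ∂(Measure.pi fun _ : Fin m => stdGaussian (EuclideanSpace ℝ (Fin d))) =
      ∫⁻ w, g w ∂(stdGaussian (EuclideanSpace ℝ (Fin d))) := fun r =>
    (measurePreserving_eval (fun _ : Fin m => stdGaussian (EuclideanSpace ℝ (Fin d)))
      r).lintegral_comp hg
  simp [h]

lemma measurable_net {m d : ℕ} (z : EuclideanSpace ℝ (Fin d)) :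
    Measurable fun p : Weights m d × (Fin m → ℝ) => net p.2 p.1 z := by
  have := measurable_relu
  unfold net
  fun_prop

/-- At the initialization the outputs have second moment at most one: the signs remove the cross
terms. -/
lemma lintegral_net_sq_le {m d : ℕ} (hm : 0 < m) {z : EuclideanSpace ℝ (Fin d)} (hz : ‖z‖ = 1) :
    ∫⁻ p, ENNReal.ofReal (net p.2 p.1 z ^ 2) ∂(initLaw m d) ≤ 1 := by
  have hmr : (0 : ℝ) < m := by exact_mod_cast hm
  rw [initLaw, lintegral_prod _ ((measurable_net z).pow_const 2).ennreal_ofReal.aemeasurable]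
  have hinner : ∀ W : Weights m d, ∫⁻ a, ENNReal.ofReal (net a W z ^ 2)
      ∂(Measure.pi fun _ : Fin m => uniformOn ({-1, 1} : Set ℝ)) ≤
      ENNReal.ofReal (1 / m) * ∑ r, ENNReal.ofReal (⟪W r, z⟫ ^ 2) := by
    intro W
    have e : ∀ a : Fin m → ℝ, ENNReal.ofReal (net a W z ^ 2) =
        ENNReal.ofReal (1 / m) * ENNReal.ofReal ((∑ r, a r * relu ⟪W r, z⟫) ^ 2) := by
      intro a
      rw [← ENNReal.ofReal_mul (by positivity), net, mul_pow, div_pow, one_pow,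
        Real.sq_sqrt hmr.le]
    simp_rw [e]
    rw [lintegral_const_mul _ (by fun_prop)]
    gcongr
    refine (lintegral_sq_sum_signs_le _).trans (Finset.sum_le_sum fun r _ => ?_)
    exact ENNReal.ofReal_le_ofReal (relu_sq_le _)
  refine (lintegral_mono hinner).trans ?_
  rw [lintegral_const_mul _ (by fun_prop),
    lintegral_pi_sum (g := fun w => ENNReal.ofReal (⟪w, z⟫ ^ 2)) (by fun_prop),
    lintegral_inner_sq hz, mul_one, ← ENNReal.ofReal_natCast m,
    ← ENNReal.ofReal_mul (by positivity), one_div, inv_mul_cancel₀ hmr.ne', ENNReal.ofReal_one]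

/-- Tail bound for the initial residual, from a second moment of order `n`. -/
lemma initLaw_residual_ge_le {n m d : ℕ} (hm : 0 < m) {x : Fin n → EuclideanSpace ℝ (Fin d)}
    (hx : ∀ i, ‖x i‖ = 1) {y : Fin n → ℝ} {B : ℝ} (hy : ∀ i, |y i| ≤ B) {t : ℝ} (ht : 0 < t) :
    initLaw m d {p | t ≤ ‖residual x y p.2 p.1‖ ^ 2} ≤
      ENNReal.ofReal (n * (2 + 2 * B ^ 2) / t) := by
  have hmeas : ∀ i, Measurable fun p : Weights m d × (Fin m → ℝ) => net p.2 p.1 (x i) :=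
    fun i => measurable_net (x i)
  have e : ∀ p : Weights m d × (Fin m → ℝ),
      ‖residual x y p.2 p.1‖ ^ 2 = ∑ i, (net p.2 p.1 (x i) - y i) ^ 2 := fun p => by
    simp [EuclideanSpace.norm_sq_eq, residual]
  simp_rw [e]
  refine measure_ge_le_ofReal_div (by fun_prop) ?_ ht
  calc ∫⁻ p, ENNReal.ofReal (∑ i, (net p.2 p.1 (x i) - y i) ^ 2) ∂(initLaw m d)
      ≤ ∫⁻ p, ∑ i, (2 * ENNReal.ofReal (net p.2 p.1 (x i) ^ 2) + ENNReal.ofReal (2 * B ^ 2))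
          ∂(initLaw m d) := by
        refine lintegral_mono fun p => ?_
        rw [ENNReal.ofReal_sum_of_nonneg fun i _ => sq_nonneg _]
        refine Finset.sum_le_sum fun i _ => ?_
        rw [← ENNReal.ofReal_ofNat 2, ← ENNReal.ofReal_mul (by norm_num),
          ← ENNReal.ofReal_add (by positivity) (by positivity)]
        refine ENNReal.ofReal_le_ofReal ?_
        have h1 : y i ^ 2 ≤ B ^ 2 := by
          rw [← sq_abs]
          have := hy i
          gcongr
        nlinarith [sq_nonneg (net p.2 p.1 (x i) + y i)]
    _ = ∑ i, (2 * ∫⁻ p, ENNReal.ofReal (net p.2 p.1 (x i) ^ 2) ∂(initLaw m d)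
          + ENNReal.ofReal (2 * B ^ 2)) := by
        rw [lintegral_finsetSum _ fun i _ => by fun_prop]
        refine Finset.sum_congr rfl fun i _ => ?_
        rw [lintegral_add_right _ measurable_const, lintegral_const_mul _ (by fun_prop)]
        simp
    _ ≤ ∑ _i : Fin n, (2 * 1 + ENNReal.ofReal (2 * B ^ 2)) := by
        gcongr with i
        exact lintegral_net_sq_le hm (hx i)
    _ = ENNReal.ofReal (n * (2 + 2 * B ^ 2)) := by
        rw [Finset.sum_const, Finset.card_univ, Fintype.card_fin, nsmul_eq_mul,
          ENNReal.ofReal_mul (Nat.cast_nonneg n), ENNReal.ofReal_natCast,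
          ENNReal.ofReal_add (by norm_num) (by positivity)]
        simp

/-- Tail bound for the fraction of near-kink units: a fixed unit is within `R` of its kink at a fixed
input with probability at most `R`. -/
lemma initLaw_nearKinkSum_ge_le {n m d : ℕ} (hm : 0 < m) {x : Fin n → EuclideanSpace ℝ (Fin d)}
    (hx : ∀ i, ‖x i‖ = 1) (R : ℝ) {t : ℝ} (ht : 0 < t) :
    initLaw m d {p | t ≤ nearKinkSum x R p.1} ≤ ENNReal.ofReal (n * R / t) := by
  have hmr : (0 : ℝ) < m := by exact_mod_cast hm
  have hk : ∀ i, Measurable fun w => nearKink R w (x i) := fun i => measurable_nearKink R (x i)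
  have hmeas : Measurable fun W : Weights m d => nearKinkSum x R W := by
    unfold nearKinkSum
    refine Finset.measurable_sum _ fun i _ => Measurable.const_mul ?_ _
    exact Finset.measurable_sum _ fun r _ => (hk i).comp (measurable_pi_apply r)
  refine measure_ge_le_ofReal_div (hmeas.comp measurable_fst) ?_ ht
  refine (lintegral_initLaw_fst (f := fun W => ENNReal.ofReal (nearKinkSum x R W))
    hmeas.ennreal_ofReal).trans_le ?_
  have e : ∀ W : Weights m d, ENNReal.ofReal (nearKinkSum x R W) =
      ∑ i, ENNReal.ofReal (1 / m) * ∑ r, ENNReal.ofReal (nearKink R (W r) (x i)) := by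
    intro W
    unfold nearKinkSum
    rw [ENNReal.ofReal_sum_of_nonneg fun i _ => mul_nonneg (by positivity)
      (Finset.sum_nonneg fun _ _ => nearKink_nonneg _ _ _)]
    refine Finset.sum_congr rfl fun i _ => ?_
    rw [ENNReal.ofReal_mul (by positivity),
      ENNReal.ofReal_sum_of_nonneg fun r _ => nearKink_nonneg _ _ _]
  have hms : ∀ i, Measurable fun W : Weights m d =>
      ∑ r, ENNReal.ofReal (nearKink R (W r) (x i)) := fun i =>
    Finset.measurable_sum _ fun r _ => ((hk i).comp (measurable_pi_apply r)).ennreal_ofReal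
  simp_rw [e]
  rw [lintegral_finsetSum _ fun i _ => (hms i).const_mul _]
  calc ∑ i, ∫⁻ W, ENNReal.ofReal (1 / m) * ∑ r, ENNReal.ofReal (nearKink R (W r) (x i))
          ∂(Measure.pi fun _ : Fin m => stdGaussian (EuclideanSpace ℝ (Fin d)))
      = ∑ i, ENNReal.ofReal (1 / m) * (m * ∫⁻ w, ENNReal.ofReal (nearKink R w (x i))
          ∂(stdGaussian (EuclideanSpace ℝ (Fin d)))) := by
        refine Finset.sum_congr rfl fun i _ => ?_
        rw [lintegral_const_mul _ (hms i),
          lintegral_pi_sum (g := fun w => ENNReal.ofReal (nearKink R w (x i)))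
            (hk i).ennreal_ofReal]
    _ ≤ ∑ _i : Fin n, ENNReal.ofReal (1 / m) * (m * ENNReal.ofReal R) := by
        gcongr with i
        exact lintegral_nearKink_le R (hx i)
    _ = ENNReal.ofReal (n * R) := by
        rw [← mul_assoc, ← ENNReal.ofReal_natCast m, ← ENNReal.ofReal_mul (by positivity),
          one_div, inv_mul_cancel₀ hmr.ne', ENNReal.ofReal_one, one_mul, Finset.sum_const,
          Finset.card_univ, Fintype.card_fin, nsmul_eq_mul,
          ENNReal.ofReal_mul (Nat.cast_nonneg n), ENNReal.ofReal_natCast]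

/-- The summand of unit `r` in the `(i, j)` entry of the empirical Gram matrix. -/
def gramUnit {d : ℕ} (m : ℕ) (u v w : EuclideanSpace ℝ (Fin d)) : ℝ :=
  1 / m * (⟪u, v⟫ * (reluDeriv ⟪w, u⟫ * reluDeriv ⟪w, v⟫))

lemma measurable_gramUnit {d : ℕ} (m : ℕ) (u v : EuclideanSpace ℝ (Fin d)) :
    Measurable (gramUnit m u v) := by
  have := measurable_reluDeriv
  unfold gramUnit
  fun_prop

lemma abs_gramUnit_le {d : ℕ} (m : ℕ) {u v : EuclideanSpace ℝ (Fin d)} (hu : ‖u‖ = 1)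
    (hv : ‖v‖ = 1) (w : EuclideanSpace ℝ (Fin d)) : |gramUnit m u v w| ≤ 1 / m := by
  unfold gramUnit
  rw [abs_mul, abs_mul, abs_mul, abs_of_nonneg (by positivity : 0 ≤ 1 / (m : ℝ))]
  refine mul_le_of_le_one_right (by positivity) ?_
  exact mul_le_one₀ (abs_inner_le_one hu hv) (by positivity)
    (mul_le_one₀ (abs_reluDeriv_le_one _) (abs_nonneg _) (abs_reluDeriv_le_one _))

lemma gramEmp_eq_sum_gramUnit {n m d : ℕ} (x : Fin n → EuclideanSpace ℝ (Fin d))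
    (W : Weights m d) (i j : Fin n) :
    gramEmp x W i j = ∑ r, gramUnit m (x i) (x j) (W r) := by
  simp [gramEmp, gramUnit, Finset.mul_sum]

lemma sum_integral_gramUnit {n m d : ℕ} (hm : 0 < m) (x : Fin n → EuclideanSpace ℝ (Fin d))
    (i j : Fin n) :
    ∑ _r : Fin m, ∫ w, gramUnit m (x i) (x j) w ∂(stdGaussian (EuclideanSpace ℝ (Fin d))) =
      gramInf x i j := by
  have hmr : (0 : ℝ) < m := by exact_mod_cast hm
  unfold gramUnit
  rw [integral_const_mul, Finset.sum_const, Finset.card_univ, Fintype.card_fin, nsmul_eq_mul,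
    ← mul_assoc, mul_one_div_cancel hmr.ne', one_mul, gramInf, Matrix.of_apply]
  congr 1
  ext w
  congr 1
  unfold reluDeriv
  split_ifs <;> simp_all

/-- A single-unit empirical Gram matrix has mean `H` and entries in `[-1, 1]`. -/
lemma gramInf_diag_le_one {n d : ℕ} {x : Fin n → EuclideanSpace ℝ (Fin d)}
    (hx : ∀ i, ‖x i‖ = 1) (i : Fin n) : gramInf x i i ≤ 1 := by
  rw [← sum_integral_gramUnit one_pos]
  have h : ∀ w, ‖gramUnit 1 (x i) (x i) w‖ ≤ 1 := fun w => by
    simpa using abs_gramUnit_le 1 (hx i) (hx i) w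
  have h2 := norm_integral_le_of_norm_le_const (μ := stdGaussian (EuclideanSpace ℝ (Fin d)))
    (Filter.Eventually.of_forall h)
  simp only [Finset.univ_unique, Finset.sum_const, Finset.card_singleton, one_smul]
  exact (Real.le_norm_self _).trans (h2.trans (by simp))

/-- Tail bound for `‖H(0) - H‖_F²`: each entry is an average of `m` independent bounded variables,
so its variance is at most `1/m`. -/
lemma initLaw_gramEmp_ge_le {n m d : ℕ} (hm : 0 < m) {x : Fin n → EuclideanSpace ℝ (Fin d)}
    (hx : ∀ i, ‖x i‖ = 1) {t : ℝ} (ht : 0 < t) :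
    initLaw m d {p | t ≤ ∑ i, ∑ j, (gramEmp x p.1 i j - gramInf x i j) ^ 2} ≤
      ENNReal.ofReal ((n : ℝ) ^ 2 / m / t) := by
  have hmr : (0 : ℝ) < m := by exact_mod_cast hm
  have hmeas : ∀ i j, Measurable fun W : Weights m d => gramEmp x W i j := by
    intro i j
    have := measurable_gramUnit m (x i) (x j)
    simp_rw [gramEmp_eq_sum_gramUnit]
    fun_prop
  have hsq : ∀ i j, Measurable fun W : Weights m d =>
      ENNReal.ofReal ((gramEmp x W i j - gramInf x i j) ^ 2) := fun i j => by
    have := hmeas i j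
    fun_prop
  have hF : Measurable fun W : Weights m d =>
      ∑ i, ∑ j, (gramEmp x W i j - gramInf x i j) ^ 2 :=
    Finset.measurable_sum _ fun i _ => Finset.measurable_sum _ fun j _ =>
      ((hmeas i j).sub_const _).pow_const 2
  refine measure_ge_le_ofReal_div (hF.comp measurable_fst) ?_ ht
  refine (lintegral_initLaw_fst (f := fun W =>
    ENNReal.ofReal (∑ i, ∑ j, (gramEmp x W i j - gramInf x i j) ^ 2))
    hF.ennreal_ofReal).trans_le ?_
  have e : ∀ W : Weights m d,
      ENNReal.ofReal (∑ i, ∑ j, (gramEmp x W i j - gramInf x i j) ^ 2) =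
        ∑ i, ∑ j, ENNReal.ofReal ((gramEmp x W i j - gramInf x i j) ^ 2) := by
    intro W
    rw [ENNReal.ofReal_sum_of_nonneg fun i _ => Finset.sum_nonneg fun j _ => sq_nonneg _]
    refine Finset.sum_congr rfl fun i _ => ?_
    rw [ENNReal.ofReal_sum_of_nonneg fun j _ => sq_nonneg _]
  simp_rw [e]
  have hentry : ∀ i j, ∫⁻ W, ENNReal.ofReal ((gramEmp x W i j - gramInf x i j) ^ 2)
      ∂(Measure.pi fun _ : Fin m => stdGaussian (EuclideanSpace ℝ (Fin d))) ≤
      ENNReal.ofReal (1 / m) := by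
    intro i j
    have hbound := abs_gramUnit_le m (hx i) (hx j)
    have hmem : MemLp (gramUnit m (x i) (x j)) 2 (stdGaussian (EuclideanSpace ℝ (Fin d))) :=
      MemLp.of_bound (measurable_gramUnit m (x i) (x j)).aestronglyMeasurable (1 / m)
        (Filter.Eventually.of_forall hbound)
    have h := lintegral_sq_sum_pi_sub (ι := Fin m) (X := fun _ => gramUnit m (x i) (x j))
      fun _ => hmem
    simp_rw [sum_integral_gramUnit hm, ← gramEmp_eq_sum_gramUnit] at h
    rw [h]
    refine ENNReal.ofReal_le_ofReal ?_
    have hvar : Var[gramUnit m (x i) (x j); stdGaussian (EuclideanSpace ℝ (Fin d))] ≤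
        (1 / (m : ℝ)) ^ 2 := by
      refine (variance_le_expectation_sq
        (measurable_gramUnit m (x i) (x j)).aestronglyMeasurable).trans ?_
      have h1 : ∀ w, ‖((gramUnit m (x i) (x j)) ^ 2) w‖ ≤ (1 / (m : ℝ)) ^ 2 := by
        intro w
        rw [Pi.pow_apply, norm_pow, Real.norm_eq_abs]
        have := hbound w
        gcongr
      have h2 := norm_integral_le_of_norm_le_const
        (μ := stdGaussian (EuclideanSpace ℝ (Fin d))) (Filter.Eventually.of_forall h1)
      exact (Real.le_norm_self _).trans (h2.trans (by simp))
    calc ∑ _r : Fin m, Var[gramUnit m (x i) (x j); stdGaussian (EuclideanSpace ℝ (Fin d))]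
        ≤ ∑ _r : Fin m, (1 / (m : ℝ)) ^ 2 := Finset.sum_le_sum fun _ _ => hvar
      _ = 1 / m := by
          rw [Finset.sum_const, Finset.card_univ, Fintype.card_fin, nsmul_eq_mul]
          field_simp
  rw [lintegral_finsetSum _ fun i _ => Finset.measurable_sum _ fun j _ => hsq i j]
  calc ∑ i, ∫⁻ W, ∑ j, ENNReal.ofReal ((gramEmp x W i j - gramInf x i j) ^ 2)
          ∂(Measure.pi fun _ : Fin m => stdGaussian (EuclideanSpace ℝ (Fin d)))
      ≤ ∑ _i : Fin n, ∑ _j : Fin n, ENNReal.ofReal (1 / m) := by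
        refine Finset.sum_le_sum fun i _ => ?_
        rw [lintegral_finsetSum _ fun j _ => hsq i j]
        exact Finset.sum_le_sum fun j _ => hentry i j
    _ = ENNReal.ofReal ((n : ℝ) ^ 2 / m) := by
        rw [Finset.sum_const, Finset.sum_const, Finset.card_univ, Fintype.card_fin, nsmul_eq_mul,
          nsmul_eq_mul, ← ENNReal.ofReal_natCast n, ← ENNReal.ofReal_mul (by positivity),
          ← ENNReal.ofReal_mul (by positivity)]
        congr 1
        ring

/-! ### Convergence with high probability -/

/-- A matrix of size zero has empty spectrum, for which `lamMin` takes the value `sInf ∅ = 0`. -/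
lemma pos_of_lamMin_pos {n : ℕ} {A : Matrix (Fin n) (Fin n) ℝ} (h : 0 < lamMin A) : 0 < n := by
  rcases Nat.eq_zero_or_pos n with rfl | hn
  · rw [lamMin, spectrum.of_subsingleton, Real.sInf_empty] at h
    exact absurd h (lt_irrefl 0)
  · exact hn

/-- Geometric decay of the residual for step sizes up to `c₂ / ‖H‖` with `c₂ < 2`. The loss of the
factor `κ ≤ (2 - c₂) / c₂` in the rate accounts for the eigenvalues of `η H` close to `2`. -/
lemma norm_residual_gd_le_of_good_init {n m d : ℕ} (hm : 0 < m)
    {x : Fin n → EuclideanSpace ℝ (Fin d)} (hx : ∀ i, ‖x i‖ = 1) (y : Fin n → ℝ)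
    {a : Fin m → ℝ} (ha : ∀ r, |a r| = 1) {W₀ : Weights m d} {η κ c₂ R : ℝ}
    (hlam : 0 < lamMin (gramInf x)) (hκ : 0 < κ) (hκ1 : κ ≤ 1) (hκ2 : κ * c₂ ≤ 2 - c₂)
    (hη : 0 < η) (hη2 : η * lamMax (gramInf x) ≤ c₂)
    (hgram : ∑ i, ∑ j, (gramEmp x W₀ i j - gramInf x i j) ^ 2 ≤
      (κ * lamMin (gramInf x) / 4) ^ 2)
    (hkink : 3 * n * nearKinkSum x R W₀ ≤ κ * lamMin (gramInf x) / 4)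
    (hR : 2 / (κ * lamMin (gramInf x)) * (1 / √m * √n) * ‖residual x y a W₀‖ ≤ R) (k : ℕ) :
    0 ≤ 1 - κ * η * lamMin (gramInf x) / 2 ∧
    ‖residual x y a (gd x y η a W₀ k)‖ ≤
      (1 - κ * η * lamMin (gramInf x) / 2) ^ k * ‖residual x y a W₀‖ := by
  have hA := isHermitian_gramInf x
  have hle : lamMin (gramInf x) ≤ lamMax (gramInf x) :=
    (lamMin_le_eigenvalues hA ⟨0, pos_of_lamMin_pos hlam⟩).trans (eigenvalues_le_lamMax hA _)
  set l := lamMin (gramInf x)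
  set L := lamMax (gramInf x)
  have h1 : η * l ≤ c₂ := (mul_le_mul_of_nonneg_left hle hη.le).trans hη2
  have h2 : κ * (η * l) ≤ 2 - c₂ := (mul_le_mul_of_nonneg_left h1 hκ.le).trans hκ2
  have h3 : 0 < κ * (η * l) := by positivity
  have h4 : κ * (η * l) ≤ η * l := mul_le_of_le_one_left (by positivity) hκ1
  have hspec : ∀ i, |1 - η * hA.eigenvalues i| ≤ 1 - κ * (η * l) := by
    intro i
    have e1 : η * l ≤ η * hA.eigenvalues i :=
      mul_le_mul_of_nonneg_left (lamMin_le_eigenvalues hA i) hη.le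
    have e2 : η * hA.eigenvalues i ≤ c₂ :=
      (mul_le_mul_of_nonneg_left (eigenvalues_le_lamMax hA i) hη.le).trans hη2
    rw [abs_le]
    constructor <;> linarith
  have hc0 : 0 ≤ 1 - κ * (η * l) :=
    (abs_nonneg _).trans (hspec ⟨0, pos_of_lamMin_pos hlam⟩)
  have hρ : 0 ≤ 1 - κ * η * l / 2 := by linarith
  refine ⟨hρ, (norm_residual_gd_le hx y ha hη.le hρ ?_ (by positivity) hR ?_ k).2⟩
  · field_simp
    ring
  · intro W W' hstep hW hW'
    refine (norm_residual_step_le hx y ha hη.le hstep hW hW'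
      (norm_sub_smul_toEuclideanLin_le hA hc0 hspec) hgram (by positivity)).trans ?_
    gcongr
    have e1 : 3 * η * n * nearKinkSum x R W₀ ≤ η * (κ * l / 4) := by
      calc 3 * η * n * nearKinkSum x R W₀ = η * (3 * n * nearKinkSum x R W₀) := by ring
        _ ≤ η * (κ * l / 4) := by gcongr
    linarith

/-- After `T ≥ K (‖H‖ / λ₀) (log (1/ε) + log (n/δ) + 1)` steps the geometric decay has brought an
initial squared residual of order `n / δ` below `2 ε`. -/
lemma half_sq_le_of_geometric_decay {κ c₁ b l L η ε δ ν e₀ e : ℝ} {T : ℕ} (hκ : 0 < κ)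
    (hc₁ : 0 < c₁) (hb : 1 ≤ b) (hl : 0 < l) (hL : 0 < L) (hη : c₁ / L ≤ η) (hε : 0 < ε)
    (hε1 : ε ≤ 1) (hδ : 0 < δ) (hδ1 : δ < 1) (hν : 1 ≤ ν) (he0 : 0 ≤ e)
    (hρ : 0 ≤ 1 - κ * η * l / 2) (he : e ≤ (1 - κ * η * l / 2) ^ T * e₀)
    (he₀ : e₀ ^ 2 ≤ 2 * (b * (ν / δ)))
    (hT : (1 + Real.log b) / (κ * c₁) * (L / l) *
      (Real.log (1 / ε) + Real.log (ν / δ) + 1) ≤ T) :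
    1 / 2 * e ^ 2 ≤ ε := by
  have hlogb : 0 ≤ Real.log b := Real.log_nonneg hb
  have hlogε : 0 ≤ Real.log (1 / ε) := Real.log_nonneg ((one_le_div hε).mpr hε1)
  have hνδ : 1 ≤ ν / δ := (one_le_div hδ).mpr (by linarith)
  have hlogν : 0 ≤ Real.log (ν / δ) := Real.log_nonneg hνδ
  set S := Real.log (1 / ε) + Real.log (ν / δ) + 1 with hS
  have hexp : Real.log (1 / ε) + Real.log (ν / δ) + Real.log b ≤ κ * η * l * T := by
    calc Real.log (1 / ε) + Real.log (ν / δ) + Real.log b ≤ (1 + Real.log b) * S := by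
          nlinarith
      _ = κ * (c₁ / L) * l * ((1 + Real.log b) / (κ * c₁) * (L / l) * S) := by
          field_simp
      _ ≤ κ * η * l * T := by
          have hη0 : 0 < η := lt_of_lt_of_le (by positivity) hη
          gcongr
  have hpow : ((1 - κ * η * l / 2) ^ T) ^ 2 ≤ Real.exp (-(κ * η * l * T)) := by
    calc ((1 - κ * η * l / 2) ^ T) ^ 2 ≤ (Real.exp (-(κ * η * l / 2)) ^ T) ^ 2 := by
          gcongr
          linarith [Real.add_one_le_exp (-(κ * η * l / 2))]
      _ = Real.exp (-(κ * η * l * T)) := by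
          rw [← Real.exp_nat_mul, ← Real.exp_nat_mul]
          congr 1
          push_cast
          ring
  have hexp2 : Real.exp (-(κ * η * l * T)) ≤ ε * (b * (ν / δ))⁻¹ := by
    rw [← Real.le_log_iff_exp_le (by positivity), Real.log_mul (by positivity) (by positivity),
      Real.log_inv, Real.log_mul (by positivity) (by positivity)]
    rw [one_div, Real.log_inv] at hexp
    linarith
  calc 1 / 2 * e ^ 2 ≤ 1 / 2 * ((1 - κ * η * l / 2) ^ T * e₀) ^ 2 := by gcongr
    _ = 1 / 2 * (((1 - κ * η * l / 2) ^ T) ^ 2 * e₀ ^ 2) := by ring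
    _ ≤ 1 / 2 * (ε * (b * (ν / δ))⁻¹ * (2 * (b * (ν / δ)))) := by
        gcongr
        exact hpow.trans hexp2
    _ = ε := by
        field_simp

end TwoLayer

end

open TwoLayer in
theorem mainTheorem3 :
    ∀ c₂ : ℝ, 0 < c₂ → c₂ < 2 → ∀ B : ℝ, 0 ≤ B →
    ∃ C : ℝ, 0 < C ∧ ∀ c₁ : ℝ, 0 < c₁ → c₁ ≤ c₂ →
    ∃ K : ℝ, 0 < K ∧
    ∀ (n d m : ℕ) (x : Fin n → EuclideanSpace ℝ (Fin d)) (y : Fin n → ℝ) (δ ε η : ℝ),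
      (∀ i, ‖x i‖ = 1) → (∀ i, |y i| ≤ B) →
      0 < TwoLayer.lamMin (TwoLayer.gramInf x) →
      0 < δ → δ < 1 → 0 < ε → ε ≤ 1 →
      C * ((n : ℝ) ^ 8 / (TwoLayer.lamMin (TwoLayer.gramInf x) ^ 4 * δ ^ 3)) ≤ (m : ℝ) →
      c₁ / TwoLayer.lamMax (TwoLayer.gramInf x) ≤ η →
      η ≤ c₂ / TwoLayer.lamMax (TwoLayer.gramInf x) →
      ENNReal.ofReal (1 - δ) ≤
        TwoLayer.initLaw m d
          {p | ∀ T : ℕ,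
            K * (TwoLayer.lamMax (TwoLayer.gramInf x) / TwoLayer.lamMin (TwoLayer.gramInf x)) *
                (Real.log (1 / ε) + Real.log (n / δ) + 1) ≤ (T : ℝ) →
            TwoLayer.loss x y p.2 (TwoLayer.gd x y η p.2 p.1 T) ≤ ε} := by
  intro c₂ hc₂ hc₂2 B hB
  -- This `κ` satisfies `κ ≤ 1` and `κ c₂ ≤ 2 - c₂`, all that the spectral bound asks of it.
  set κ : ℝ := (2 - c₂) / 2 with hκdef
  have hκ : 0 < κ := by rw [hκdef]; linarith
  have hκ1 : κ ≤ 1 := by rw [hκdef]; linarith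
  have hκ2 : κ * c₂ ≤ 2 - c₂ := by rw [hκdef]; nlinarith
  refine ⟨31104 * (1 + B ^ 2) / κ ^ 4, by positivity, fun c₁ hc₁ _ => ?_⟩
  have hb : 1 ≤ 3 * (1 + B ^ 2) := by nlinarith [sq_nonneg B]
  have hlogb : 0 ≤ Real.log (3 * (1 + B ^ 2)) := Real.log_nonneg hb
  refine ⟨(1 + Real.log (3 * (1 + B ^ 2))) / (κ * c₁), by positivity, ?_⟩
  intro n d m x y δ ε η hx hy hlam hδ hδ1 hε hε1 hm hη₁ hη₂
  have hA := isHermitian_gramInf x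
  have hn := pos_of_lamMin_pos hlam
  have hle : lamMin (gramInf x) ≤ lamMax (gramInf x) :=
    (lamMin_le_eigenvalues hA ⟨0, hn⟩).trans (eigenvalues_le_lamMax hA _)
  have hl1 : lamMin (gramInf x) ≤ 1 := lamMin_le_one hA hn (gramInf_diag_le_one hx)
  have hn1 : (1 : ℝ) ≤ n := by exact_mod_cast hn
  have hn0 : (0 : ℝ) < n := by linarith
  set l := lamMin (gramInf x) with hl
  set L := lamMax (gramInf x) with hL
  have hL0 : 0 < L := hlam.trans_le hle
  have hmr : (0 : ℝ) < m := lt_of_lt_of_le (by positivity) hm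
  have hm0 : 0 < m := by exact_mod_cast hmr
  have hη : 0 < η := lt_of_lt_of_le (by positivity) hη₁
  have hη₂' : η * L ≤ c₂ := (le_div_iff₀ hL0).mp hη₂
  have hwidth : 31104 * (1 + B ^ 2) * (n : ℝ) ^ 8 ≤ m * (κ ^ 4 * l ^ 4 * δ ^ 3) := by
    rw [div_mul_div_comm, div_le_iff₀ (by positivity)] at hm
    linarith
  -- With this radius the Markov bound `n R / t` for the near-kink units equals `δ / 3` at the
  -- largest tolerable count `t = κ λ₀ / (12 n)`.
  set R : ℝ := κ * l * δ / (36 * n ^ 2) with hR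
  have hR0 : 0 ≤ R := by positivity
  -- Each threshold below is exceeded with probability at most `δ / 3`; `E₂` and `E₃` are where the
  -- perturbation of `I - η H` may use up more than a quarter of its spectral gap.
  set E₁ := {p : Weights m d × (Fin m → ℝ) |
    6 * n * (1 + B ^ 2) / δ ≤ ‖residual x y p.2 p.1‖ ^ 2} with hE₁
  set E₂ := {p : Weights m d × (Fin m → ℝ) |
    (κ * l / 4) ^ 2 ≤ ∑ i, ∑ j, (gramEmp x p.1 i j - gramInf x i j) ^ 2} with hE₂
  set E₃ := {p : Weights m d × (Fin m → ℝ) | κ * l / (12 * n) ≤ nearKinkSum x R p.1} with hE₃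
  set N := {p : Weights m d × (Fin m → ℝ) | ¬ ∀ r, |p.2 r| = 1} with hN
  have hN0 : initLaw m d N = 0 := ae_abs_eq_one_initLaw m d
  have h₁ : initLaw m d E₁ ≤ ENNReal.ofReal (δ / 3) := by
    refine (initLaw_residual_ge_le hm0 hx hy (by positivity)).trans_eq ?_
    congr 1
    field_simp
    norm_num
  have h₂ : initLaw m d E₂ ≤ ENNReal.ofReal (δ / 3) := by
    refine (initLaw_gramEmp_ge_le hm0 hx (by positivity)).trans (ENNReal.ofReal_le_ofReal ?_)
    have hsmall : 48 * (n : ℝ) ^ 2 ≤ m * (κ ^ 2 * l ^ 2 * δ) := by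
      calc 48 * (n : ℝ) ^ 2 ≤ 31104 * (1 + B ^ 2) * (n : ℝ) ^ 8 := by
            have e1 : (n : ℝ) ^ 2 ≤ n ^ 8 := pow_le_pow_right₀ hn1 (by norm_num)
            nlinarith [sq_nonneg B, mul_nonneg (sq_nonneg B) (pow_nonneg hn0.le 8)]
        _ ≤ m * (κ ^ 4 * l ^ 4 * δ ^ 3) := hwidth
        _ ≤ m * (κ ^ 2 * l ^ 2 * δ) := by
            have e1 : κ ^ 4 ≤ κ ^ 2 := pow_le_pow_of_le_one hκ.le hκ1 (by norm_num)
            have e2 : l ^ 4 ≤ l ^ 2 := pow_le_pow_of_le_one hlam.le hl1 (by norm_num)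
            have e3 : δ ^ 3 ≤ δ := pow_le_of_le_one hδ.le hδ1.le (by norm_num)
            gcongr
    rw [div_div, div_le_iff₀ (by positivity)]
    linarith
  have h₃ : initLaw m d E₃ ≤ ENNReal.ofReal (δ / 3) := by
    refine (initLaw_nearKinkSum_ge_le hm0 hx R (by positivity)).trans_eq ?_
    congr 1
    rw [hR]
    field_simp
    norm_num
  -- Only the inclusion of the complement in the bad events is used, so the measurability of the
  -- event in the claim plays no role.
  have hsub : (Set.univ : Set (Weights m d × (Fin m → ℝ))) ⊆
      {p | ∀ T : ℕ, (1 + Real.log (3 * (1 + B ^ 2))) / (κ * c₁) * (L / l) *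
          (Real.log (1 / ε) + Real.log (n / δ) + 1) ≤ (T : ℝ) →
          loss x y p.2 (gd x y η p.2 p.1 T) ≤ ε} ∪ (N ∪ (E₁ ∪ (E₂ ∪ E₃))) := by
    intro p _
    by_contra hp
    simp only [Set.mem_union, not_or] at hp
    obtain ⟨hp, hpN, hp₁, hp₂, hp₃⟩ := hp
    refine hp fun T hT => ?_
    have ha : ∀ r, |p.2 r| = 1 := not_not.mp hpN
    have hres : ‖residual x y p.2 p.1‖ ^ 2 ≤ 6 * n * (1 + B ^ 2) / δ := (not_le.mp hp₁).le
    have hgram : ∑ i, ∑ j, (gramEmp x p.1 i j - gramInf x i j) ^ 2 ≤ (κ * l / 4) ^ 2 :=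
      (not_le.mp hp₂).le
    have hkink : 3 * n * nearKinkSum x R p.1 ≤ κ * l / 4 := by
      calc 3 * n * nearKinkSum x R p.1 ≤ 3 * n * (κ * l / (12 * n)) := by
            have : nearKinkSum x R p.1 ≤ κ * l / (12 * n) := (not_le.mp hp₃).le
            gcongr
        _ = κ * l / 4 := by field_simp; norm_num
    have hrad : 2 / (κ * l) * (1 / √m * √n) * ‖residual x y p.2 p.1‖ ≤ R := by
      refine le_of_sq_le_sq ?_ hR0
      calc (2 / (κ * l) * (1 / √m * √n) * ‖residual x y p.2 p.1‖) ^ 2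
          = (2 / (κ * l)) ^ 2 * (n / m) * ‖residual x y p.2 p.1‖ ^ 2 := by
            rw [mul_pow, mul_pow, mul_pow, div_pow 1, Real.sq_sqrt hmr.le, Real.sq_sqrt hn0.le]
            ring
        _ ≤ (2 / (κ * l)) ^ 2 * (n / m) * (6 * n * (1 + B ^ 2) / δ) := by gcongr
        _ = 24 * (1 + B ^ 2) * n ^ 2 / (κ ^ 2 * l ^ 2 * δ * m) := by field_simp; norm_num
        _ ≤ κ ^ 2 * l ^ 2 * δ ^ 2 / (1296 * n ^ 4) := by
            rw [div_le_div_iff₀ (by positivity) (by positivity)]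
            have e1 : (n : ℝ) ^ 6 ≤ n ^ 8 := pow_le_pow_right₀ hn1 (by norm_num)
            calc 24 * (1 + B ^ 2) * n ^ 2 * (1296 * n ^ 4) = 31104 * (1 + B ^ 2) * n ^ 6 := by ring
              _ ≤ 31104 * (1 + B ^ 2) * n ^ 8 := by gcongr
              _ ≤ m * (κ ^ 4 * l ^ 4 * δ ^ 3) := hwidth
              _ = κ ^ 2 * l ^ 2 * δ ^ 2 * (κ ^ 2 * l ^ 2 * δ * m) := by ring
        _ = R ^ 2 := by rw [hR]; field_simp; norm_num
    obtain ⟨hρ, hdecay⟩ := norm_residual_gd_le_of_good_init hm0 hx y ha hlam hκ hκ1 hκ2 hη hη₂'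
      hgram hkink hrad T
    rw [loss_eq]
    exact half_sq_le_of_geometric_decay hκ hc₁ hb hlam hL0 hη₁ hε hε1 hδ hδ1 hn1
      (norm_nonneg _) hρ hdecay (hres.trans_eq (by ring)) hT
  have hone : (1 : ENNReal) = initLaw m d Set.univ := measure_univ.symm
  have hsum : ENNReal.ofReal (δ / 3) + (ENNReal.ofReal (δ / 3) + ENNReal.ofReal (δ / 3)) =
      ENNReal.ofReal δ := by
    rw [← ENNReal.ofReal_add (by positivity) (by positivity),
      ← ENNReal.ofReal_add (by positivity) (by positivity)]
    congr 1
    ring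
  rw [ENNReal.ofReal_sub 1 hδ.le, ENNReal.ofReal_one, tsub_le_iff_right, hone]
  refine (measure_mono hsub).trans ((measure_union_le _ _).trans ?_)
  gcongr
  refine (measure_union_le _ _).trans ?_
  rw [hN0, zero_add, ← hsum]
  refine (measure_union_le _ _).trans (add_le_add h₁ ?_)
  exact (measure_union_le _ _).trans (add_le_add h₂ h₃)
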